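/- Let $R$ be a ring with identity and let $U$ be a uniserial right $R$-module, that is, a right $R$-module whose submodules are linearly ordered by inclusion. Suppose that $U$ is of type $1$, that is, that its endomorphism ring $S=\operatorname{End}(U_R)$ is local. Let $\operatorname{Add}(U)$ be the class of all right $R$-modules isomorphic to a direct summand of a direct sum $U^{(X)}$ of copies of $U$, for some set $X$. An $\operatorname{Add}(U)$-precover of a right $R$-module $M$ is a homomorphism $f\colon C\to M$ with $C\in\operatorname{Add}(U)$ such that every homomorphism $D\to M$ with $D\in\operatorname{Add}(U)$ factors through $f$; it is an $\operatorname{Add}(U)$-cover if, moreover, every endomorphism $h$ of $C$ with $fh=f$ is an automorphism. The class $\operatorname{Add}(U)$ is covering if every right $R$-module has an $\operatorname{Add}(U)$-cover. Let $U_e\subseteq U$ be the union of the kernels of all surjective endomorphisms of $U$; since these kernels form a chain, $U_e$ is a submodule of $U$. Then: (a) If $\operatorname{Add}(U)$ is covering, then $U_e=0$ or $U_e=U$. (b) If $0\neq U_e\subsetneq U$, then the module $U/U_e$ has no $\operatorname{Add}(U)$-cover. -/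

import Mathlib

universe u v

namespace UniserialCover

/-- A module is uniserial if its submodules are linearly ordered by inclusion.
(Everything is set up for `Module A _`; right modules over a ring `R` are the case `A = Rᵐᵒᵖ`.) -/
def IsUniserial (A : Type u) [Ring A] (U : Type v) [AddCommGroup U] [Module A U] : Prop :=
  ∀ N P : Submodule A U, N ≤ P ∨ P ≤ N

/-- A class of `A`-modules. -/
abbrev ModuleClass (A : Type u) [Ring A] : Type (max u (v + 1)) :=
  ∀ (M : Type v) [AddCommGroup M] [Module A M], Prop

/-- The class `Add(U)`: modules isomorphic to a direct summand of a direct sum `U^(X)` of copies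
of `U`, where `X` is any index set. -/
def IsInAdd (A : Type u) [Ring A] (U : Type v) [AddCommGroup U] [Module A U] :
    ModuleClass.{u, v} A :=
  fun M _ _ => ∃ (X N : Type v) (_ : AddCommGroup N) (_ : Module A N),
    Nonempty ((M × N) ≃ₗ[A] (X →₀ U))

/-- `f : C → M` is a `𝒞`-precover of `M`: `C` is in `𝒞` and every homomorphism from a module
of `𝒞` to `M` factors through `f`. -/
def IsPrecover {A : Type u} [Ring A] (𝒞 : ModuleClass.{u, v} A)
    {C M : Type v} [AddCommGroup C] [Module A C] [AddCommGroup M] [Module A M]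
    (f : C →ₗ[A] M) : Prop :=
  𝒞 C ∧ ∀ (D : Type v) [AddCommGroup D] [Module A D], 𝒞 D →
    ∀ g : D →ₗ[A] M, ∃ h : D →ₗ[A] C, f ∘ₗ h = g

/-- A `𝒞`-cover is a `𝒞`-precover `f : C → M` such that every endomorphism `h` of `C` with
`f h = f` is an automorphism. -/
def IsCover {A : Type u} [Ring A] (𝒞 : ModuleClass.{u, v} A)
    {C M : Type v} [AddCommGroup C] [Module A C] [AddCommGroup M] [Module A M]
    (f : C →ₗ[A] M) : Prop :=
  IsPrecover 𝒞 f ∧ ∀ h : C →ₗ[A] C, f ∘ₗ h = f → Function.Bijective h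

/-- `M` has a `𝒞`-cover. -/
def HasCover {A : Type u} [Ring A] (𝒞 : ModuleClass.{u, v} A)
    (M : Type v) [AddCommGroup M] [Module A M] : Prop :=
  ∃ (C : Type v) (_ : AddCommGroup C) (_ : Module A C) (f : C →ₗ[A] M), IsCover 𝒞 f

/-- The class `𝒞` is covering: every module has a `𝒞`-cover. -/
def IsCovering {A : Type u} [Ring A] (𝒞 : ModuleClass.{u, v} A) : Prop :=
  ∀ (M : Type v) [AddCommGroup M] [Module A M], HasCover 𝒞 M

/-- `U_e`: the union of the kernels of all surjective endomorphisms of a uniserial module `U`.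
It is a submodule, because the kernels form a chain. -/
def epiKernelUnion {A : Type u} [Ring A] {U : Type v} [AddCommGroup U] [Module A U]
    (hU : IsUniserial A U) : Submodule A U where
  carrier := ⋃ (f : Module.End A U) (_ : Function.Surjective f), (LinearMap.ker f : Set U)
  zero_mem' := by
    simp only [Set.mem_iUnion, SetLike.mem_coe]
    exact ⟨LinearMap.id, Function.surjective_id, Submodule.zero_mem _⟩
  add_mem' := by
    intro a b ha hb
    simp only [Set.mem_iUnion, SetLike.mem_coe] at ha hb ⊢
    obtain ⟨f, hf, ha⟩ := ha
    obtain ⟨g, hg, hb⟩ := hb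
    rcases hU (LinearMap.ker f) (LinearMap.ker g) with h | h
    · exact ⟨g, hg, Submodule.add_mem _ (h ha) hb⟩
    · exact ⟨f, hf, Submodule.add_mem _ ha (h hb)⟩
  smul_mem' := by
    intro c a ha
    simp only [Set.mem_iUnion, SetLike.mem_coe] at ha ⊢
    obtain ⟨f, hf, ha⟩ := ha
    exact ⟨f, hf, Submodule.smul_mem _ c ha⟩

end UniserialCover

/-!
Write `V = U / U_e` with projection `π`, and suppose `0 ≠ U_e ≠ U`. The key point is that *every*
homomorphism `θ : U → V` kills `U_e` (`epiKernelUnion_le_ker`).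

* If `θ` is surjective and does not kill `U_e`, then `ker θ` is strictly contained in `ker f` for
  some surjective endomorphism `f`, so `f = g θ` for some `g : V → U`. The surjective endomorphism `g π`
  has kernel inside `U_e`, so `g` is injective and `ker θ = ker f`, which is absurd.
* For arbitrary `θ`, one of `θ` and `θ - π` is surjective because the submodules of `V` form a
  chain, and both restrict to the same map on `U_e`, where `π` vanishes.

Now fix a surjective endomorphism `f` of `U` that is not injective. By the key point every
`θ : U → V` factors as `θ' f`. Let `φ : C → V` be an `Add(U)`-cover. For `x : U → C` we get
`φ x = φ x' f` for some `x' : U → C`, so `1 - (x - x' f) t` is an automorphism for every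
`t : C → U`. Since `1 - a b` is invertible exactly when `1 - b a` is, and `End(U)` is local, this
makes `t x` a nonunit for all `x` and `t` (`not_isUnit_comp_of_isCover`). But a direct summand `C`
of `U^(X)` with this property vanishes: each `c : C` is fixed by a finite sum of endomorphisms
factoring through `U`, and such a sum lies in the Jacobson radical of `End(C)`
(`eq_zero_of_isInAdd`). So `C = 0`; as `π` factors through `φ`, also `V = 0`, a contradiction.
-/

namespace UniserialCover

variable {A : Type u} [Ring A]

/-! ### Endomorphisms factoring through another module -/

section Factoring

variable {M N P : Type*} [AddCommGroup M] [Module A M] [AddCommGroup N] [Module A N]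
  [AddCommGroup P] [Module A P]

theorem isUnit_one_sub_comp_comm (a : M →ₗ[A] N) (b : N →ₗ[A] M)
    (h : IsUnit (1 - b ∘ₗ a : Module.End A M)) : IsUnit (1 - a ∘ₗ b : Module.End A N) := by
  obtain ⟨w, h1, h2⟩ := isUnit_iff_exists.mp h
  -- The geometric series suggests the inverse `1 + a (1 - b a)⁻¹ b`.
  refine isUnit_iff_exists.mpr ⟨1 + a ∘ₗ w ∘ₗ b, ?_, ?_⟩
  · ext y
    have := congrArg a (LinearMap.congr_fun h1 (b y))
    simp only [Module.End.mul_apply, LinearMap.sub_apply, Module.End.one_apply,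
      LinearMap.comp_apply, map_sub, LinearMap.add_apply, map_add] at this ⊢
    rw [← sub_eq_zero] at this ⊢
    rw [← this]
    abel
  · ext y
    have := congrArg a (LinearMap.congr_fun h2 (b y))
    simp only [Module.End.mul_apply, LinearMap.sub_apply, Module.End.one_apply,
      LinearMap.comp_apply, map_sub, LinearMap.add_apply] at this ⊢
    rw [← sub_eq_zero] at this ⊢
    rw [← this]
    abel

theorem exists_comp_eq_of_ker_le {p : M →ₗ[A] N} (hp : Function.Surjective p) (f : M →ₗ[A] P)
    (h : LinearMap.ker p ≤ LinearMap.ker f) : ∃ g : N →ₗ[A] P, g ∘ₗ p = f := by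
  refine ⟨(LinearMap.ker p).liftQ f h ∘ₗ (p.quotKerEquivOfSurjective hp).symm.toLinearMap, ?_⟩
  ext x
  have : (p.quotKerEquivOfSurjective hp).symm (p x) = Submodule.Quotient.mk x := by
    rw [LinearEquiv.symm_apply_eq]
    rfl
  simp [this]

end Factoring

variable {U : Type v} [AddCommGroup U] [Module A U]

/-! ### Homomorphisms into the quotient by the union of kernels -/

theorem mem_epiKernelUnion (hU : IsUniserial A U) {x : U} :
    x ∈ epiKernelUnion hU ↔ ∃ f : Module.End A U, Function.Surjective f ∧ f x = 0 := by
  change x ∈ (⋃ (f : Module.End A U) (_ : Function.Surjective f), (LinearMap.ker f : Set U)) ↔ _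
  simp

theorem IsUniserial.of_surjective {V : Type*} [AddCommGroup V] [Module A V]
    (hU : IsUniserial A U) {p : U →ₗ[A] V} (hp : Function.Surjective p) : IsUniserial A V :=
  fun N P => (hU (N.comap p) (P.comap p)).imp (Submodule.comap_le_comap_iff_of_surjective hp).mp
    (Submodule.comap_le_comap_iff_of_surjective hp).mp

theorem epiKernelUnion_le_ker_of_surjective (hU : IsUniserial A U)
    (θ : U →ₗ[A] U ⧸ epiKernelUnion hU) (hθ : Function.Surjective θ) :
    epiKernelUnion hU ≤ LinearMap.ker θ := by
  intro x hx
  obtain ⟨f, hf, hfx⟩ := (mem_epiKernelUnion hU).mp hx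
  rcases hU (LinearMap.ker θ) (LinearMap.ker f) with h | h
  · obtain ⟨g, rfl⟩ := exists_comp_eq_of_ker_le hθ f h
    have hg : Function.Surjective g := Function.Surjective.of_comp hf
    -- `g` is injective: the kernel of the surjection `g ∘ π` lies in `U_e = ker π`.
    obtain ⟨y, hy⟩ := Submodule.mkQ_surjective _ (θ x)
    have hyU : y ∈ epiKernelUnion hU :=
      (mem_epiKernelUnion hU).mpr ⟨g ∘ₗ (epiKernelUnion hU).mkQ,
        hg.comp (Submodule.mkQ_surjective _), by simpa [← hy] using hfx⟩
    rw [LinearMap.mem_ker, ← hy]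
    simpa using hyU
  · exact h hfx

/-- Every homomorphism `U → U / U_e`, surjective or not, vanishes on `U_e`. -/
theorem epiKernelUnion_le_ker (hU : IsUniserial A U) (θ : U →ₗ[A] U ⧸ epiKernelUnion hU) :
    epiKernelUnion hU ≤ LinearMap.ker θ := by
  set π := (epiKernelUnion hU).mkQ with hπ
  have hπs : Function.Surjective π := Submodule.mkQ_surjective _
  rcases hU.of_surjective hπs (LinearMap.range θ) (LinearMap.range (θ - π)) with h | h
  · have hs : Function.Surjective (θ - π) := by
      intro z
      obtain ⟨y, rfl⟩ := hπs z
      have := Submodule.sub_mem _ (h (LinearMap.mem_range_self θ y))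
        (LinearMap.mem_range_self (θ - π) y)
      simpa using this
    intro x hx
    have h0 := epiKernelUnion_le_ker_of_surjective hU _ hs hx
    have hx0 : π x = 0 := by simpa [hπ] using hx
    simpa [hx0] using h0
  · refine epiKernelUnion_le_ker_of_surjective hU θ fun z => ?_
    obtain ⟨y, rfl⟩ := hπs z
    have := Submodule.sub_mem _ (LinearMap.mem_range_self θ y)
      (h (LinearMap.mem_range_self (θ - π) y))
    simpa using this

/-! ### Modules in `Add(U)` -/

theorem isInAdd_self : IsInAdd A U U :=
  ⟨PUnit, PUnit, inferInstance, inferInstance,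
    ⟨LinearEquiv.prodUnique ≪≫ₗ (Finsupp.uniqueLinearEquiv A U PUnit.unit).symm⟩⟩

/-- If no composite `U → C → U` is an automorphism, then finite sums of endomorphisms of `C`
factoring through `U` are quasi-regular, as they lie in the Jacobson radical of `End(C)`. -/
theorem isUnit_one_sub_sum [IsLocalRing (Module.End A U)] {C : Type*} [AddCommGroup C]
    [Module A C]
    (h : ∀ (x : U →ₗ[A] C) (t : C →ₗ[A] U), ¬ IsUnit (t ∘ₗ x : Module.End A U))
    {X : Type*} (F : Finset X) (p : X → U →ₗ[A] C) (q : X → C →ₗ[A] U) :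
    IsUnit (1 - ∑ i ∈ F, p i ∘ₗ q i : Module.End A C) := by
  classical
  induction F using Finset.induction_on with
  | empty => simp
  | insert i F hi ih =>
    obtain ⟨w, h1, -⟩ := isUnit_iff_exists.mp ih
    set s : Module.End A C := ∑ i ∈ F, p i ∘ₗ q i
    -- `1 - (s + p q) = (1 - s) (1 - ((1 - s)⁻¹ p) q)`
    have key : IsUnit (1 - (w ∘ₗ p i) ∘ₗ q i : Module.End A C) :=
      isUnit_one_sub_comp_comm _ _
        ((IsLocalRing.isUnit_or_isUnit_of_add_one (add_sub_cancel _ _)).resolve_left (h _ _))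
    have := ih.mul key
    rw [Finset.sum_insert hi]
    convert this using 1
    have e : (1 - s) * ((w ∘ₗ p i) ∘ₗ q i) = p i ∘ₗ q i := by
      change (1 - s) * (w * (p i ∘ₗ q i)) = _
      rw [← mul_assoc, h1, one_mul]
    rw [mul_sub, e, mul_one]
    abel

theorem eq_zero_of_isInAdd [IsLocalRing (Module.End A U)] {C : Type v} [AddCommGroup C]
    [Module A C] (hC : IsInAdd A U C)
    (h : ∀ (x : U →ₗ[A] C) (t : C →ₗ[A] U), ¬ IsUnit (t ∘ₗ x : Module.End A U)) (c : C) :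
    c = 0 := by
  obtain ⟨X, N, _, _, ⟨e⟩⟩ := hC
  let ι : C →ₗ[A] X →₀ U := e.toLinearMap ∘ₗ LinearMap.inl A C N
  let p : (X →₀ U) →ₗ[A] C := LinearMap.fst A C N ∘ₗ e.symm.toLinearMap
  have hpι : p (ι c) = c := by simp [p, ι]
  have hu := isUnit_one_sub_sum h (ι c).support (fun i => p ∘ₗ Finsupp.lsingle i)
    (fun i => Finsupp.lapply i ∘ₗ ι)
  refine ((Module.End.isUnit_iff _).mp hu).injective ?_
  have hsum : p (∑ i ∈ (ι c).support, Finsupp.single i (ι c i)) = c :=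
    (congrArg p (Finsupp.sum_single (ι c))).trans hpι
  rw [map_sum] at hsum
  simpa [LinearMap.sum_apply, sub_eq_zero] using hsum.symm

/-! ### Covers of the quotient -/

/-- Modulo `ker φ`, any `x : U → C` factors through a surjective nonautomorphism of `U`, while maps
with values in `ker φ` are radical because `φ` is a cover. -/
theorem not_isUnit_comp_of_isCover (hU : IsUniserial A U) [IsLocalRing (Module.End A U)]
    (hne : epiKernelUnion hU ≠ ⊥) {C : Type v} [AddCommGroup C] [Module A C]
    {φ : C →ₗ[A] U ⧸ epiKernelUnion hU} (hφ : IsCover (IsInAdd A U) φ)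
    (x : U →ₗ[A] C) (t : C →ₗ[A] U) : ¬ IsUnit (t ∘ₗ x : Module.End A U) := by
  obtain ⟨u, hu, hu0⟩ := (Submodule.ne_bot_iff _).mp hne
  obtain ⟨f, hf, hfu⟩ := (mem_epiKernelUnion hU).mp hu
  obtain ⟨θ, hθ⟩ := exists_comp_eq_of_ker_le hf (φ ∘ₗ x)
    (fun y hy => epiKernelUnion_le_ker hU (φ ∘ₗ x) ((mem_epiKernelUnion hU).mpr ⟨f, hf, hy⟩))
  obtain ⟨x', rfl⟩ := hφ.1.2 U isInAdd_self θ
  have hker : φ ∘ₗ (x - x' ∘ₗ f) = 0 := by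
    rw [LinearMap.comp_sub, ← LinearMap.comp_assoc, hθ, sub_self]
  have hnf : ¬ IsUnit ((t ∘ₗ x') ∘ₗ f : Module.End A U) := fun hunit =>
    hu0 (((Module.End.isUnit_iff _).mp hunit).injective (by simp [hfu]))
  have hnd : ¬ IsUnit (t ∘ₗ (x - x' ∘ₗ f) : Module.End A U) := by
    intro hunit
    obtain ⟨w, -, hw⟩ := isUnit_iff_exists.mp hunit
    have hb := hφ.2 (1 - (x - x' ∘ₗ f) ∘ₗ (w ∘ₗ t)) (by
      rw [LinearMap.comp_sub, ← LinearMap.comp_assoc, hker, LinearMap.zero_comp, sub_zero]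
      rfl)
    have h1 := isUnit_one_sub_comp_comm (w ∘ₗ t) (x - x' ∘ₗ f) ((Module.End.isUnit_iff _).mpr hb)
    have h2 : ((w ∘ₗ t) ∘ₗ (x - x' ∘ₗ f) : Module.End A U) = 1 := hw
    rw [h2, sub_self] at h1
    exact not_isUnit_zero h1
  have hadd := IsLocalRing.nonunits_add (a := (t ∘ₗ (x - x' ∘ₗ f) : Module.End A U))
    (b := ((t ∘ₗ x') ∘ₗ f : Module.End A U)) hnd hnf
  have heq : (t ∘ₗ (x - x' ∘ₗ f) + (t ∘ₗ x') ∘ₗ f : Module.End A U) = t ∘ₗ x := by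
    ext y
    simp
  rw [heq] at hadd
  exact hadd

theorem not_hasCover_quotient (hU : IsUniserial A U) [IsLocalRing (Module.End A U)]
    (hne : epiKernelUnion hU ≠ ⊥) (hne' : epiKernelUnion hU ≠ ⊤) :
    ¬ HasCover (IsInAdd A U) (U ⧸ epiKernelUnion hU) := by
  rintro ⟨C, _, _, φ, hφ⟩
  obtain ⟨h, hh⟩ := hφ.1.2 U isInAdd_self (epiKernelUnion hU).mkQ
  refine hne' (Submodule.eq_top_iff'.mpr fun y => ?_)
  have hy := LinearMap.congr_fun hh y
  rw [LinearMap.comp_apply, eq_zero_of_isInAdd hφ.1.1 (not_isUnit_comp_of_isCover hU hne hφ) (h y),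
    map_zero] at hy
  simpa using hy.symm

end UniserialCover

theorem theorem2p11 (R : Type u) [Ring R] (U : Type v) [AddCommGroup U] [Module Rᵐᵒᵖ U]
    (hU : UniserialCover.IsUniserial Rᵐᵒᵖ U)
    (hS : IsLocalRing (Module.End Rᵐᵒᵖ U)) :
    (UniserialCover.IsCovering.{u, v} (UniserialCover.IsInAdd Rᵐᵒᵖ U) →
      UniserialCover.epiKernelUnion hU = ⊥ ∨ UniserialCover.epiKernelUnion hU = ⊤) ∧
    (⊥ < UniserialCover.epiKernelUnion hU → UniserialCover.epiKernelUnion hU < ⊤ →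
      ¬ UniserialCover.HasCover (UniserialCover.IsInAdd Rᵐᵒᵖ U)
        (U ⧸ UniserialCover.epiKernelUnion hU)) := by
  refine ⟨fun hcov => ?_, fun h1 h2 => UniserialCover.not_hasCover_quotient hU h1.ne' h2.ne⟩
  by_contra hcon
  rw [not_or] at hcon
  exact UniserialCover.not_hasCover_quotient hU hcon.1 hcon.2 (hcov _)
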